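/- Let $\mathcal H_A,\mathcal H_B$ be finite-dimensional complex Hilbert spaces and let $\rho^{AB}$ be a state (positive semidefinite operator of unit trace) on $\mathcal H_A\otimes\mathcal H_B$, with reduced states $\rho^A=\mathrm{Tr}_B\,\rho^{AB}$ and $\rho^B=\mathrm{Tr}_A\,\rho^{AB}$. For a state $\sigma$ let $S(\sigma)=-\mathrm{Tr}\,\sigma\log_2\sigma$ be the von Neumann entropy (with $0\log_2 0=0$), and write $S(A)=S(\rho^A)$, $S(B)=S(\rho^B)$, $S(AB)=S(\rho^{AB})$. Let $$J(A|B)=\max_{\{E_i\}}\Big(S(A)-\sum_i p_i\,S(\rho_i^A)\Big),\qquad p_i=\mathrm{Tr}\big[(1\otimes E_i)\rho^{AB}\big],\qquad \rho^A_i=\tfrac1{p_i}\mathrm{Tr}_B\big[(1\otimes E_i)\rho^{AB}\big],$$ the maximum (supremum) being over all POVMs $\{E_i\}$ on $B$ with finitely many outcomes, where terms with $p_i=0$ are read as $0$; let $$D(A|B)=S(A)+S(B)-S(AB)-J(A|B)$$ be the quantum discord; and let $$E_F(A:B)=\min_{\{p_i,|\psi_i\rangle\}}\sum_i p_i\,S\big(\mathrm{Tr}_B|\psi_i\rangle\langle\psi_i|\big)$$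 be the entanglement of formation, the minimum (infimum) being over all finite pure ensembles (probabilities $p_i$ and unit vectors $\psi_i$) with $\rho^{AB}=\sum_i p_i|\psi_i\rangle\langle\psi_i|$. Then the following are equivalent: 1. $D(A|B)=S(B)$; 2. $S(A)-S(B)=S(AB)$; 3. $E_F(A:B)=S(B)$. -/

import Mathlib

open scoped Kronecker ComplexOrder

noncomputable section

namespace QInfo

/-- A quantum state (density matrix): positive semidefinite with unit trace. -/
structure IsState {n : Type*} [Fintype n] (ρ : Matrix n n ℂ) : Prop where
  posSemidef : ρ.PosSemidef
  trace_eq_one : ρ.trace = 1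

/-- The von Neumann entropy `-Tr (ρ log₂ ρ)`, the logarithm being taken by functional calculus.
Since `Real.logb 2 0 = 0`, the kernel of `ρ` contributes `0`. -/
def entropy {n : Type*} [Fintype n] [DecidableEq n] (ρ : Matrix n n ℂ) : ℝ :=
  -((ρ * cfc (Real.logb 2) ρ).trace).re

/-- The partial trace over the second system `B`. -/
def traceB {A B : Type*} [Fintype B] (ρ : Matrix (A × B) (A × B) ℂ) : Matrix A A ℂ :=
  Matrix.of fun a a' => ∑ b, ρ (a, b) (a', b)

/-- The partial trace over the first system `A`. -/
def traceA {A B : Type*} [Fintype A] (ρ : Matrix (A × B) (A × B) ℂ) : Matrix B B ℂ :=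
  Matrix.of fun b b' => ∑ a, ρ (a, b) (a, b')

/-- The von Neumann mutual information `I(A:B) = S(A) + S(B) - S(AB)`. -/
def mutualInfo {A B : Type*} [Fintype A] [DecidableEq A] [Fintype B] [DecidableEq B]
    (ρ : Matrix (A × B) (A × B) ℂ) : ℝ :=
  entropy (traceB ρ) + entropy (traceA ρ) - entropy ρ

/-- A positive operator valued measure with `k` outcomes. -/
structure POVM (B : Type*) [Fintype B] [DecidableEq B] (k : ℕ) where
  effect : Fin k → Matrix B B ℂ
  posSemidef : ∀ i, (effect i).PosSemidef
  sum_eq_one : ∑ i, effect i = 1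

/-- The unnormalized conditional state `Tr_B ((1 ⊗ E) ρ)` of `A` for the effect `E` on `B`. -/
def condOp {A B : Type*} [Fintype A] [DecidableEq A] [Fintype B]
    (ρ : Matrix (A × B) (A × B) ℂ) (E : Matrix B B ℂ) : Matrix A A ℂ :=
  traceB (((1 : Matrix A A ℂ) ⊗ₖ E) * ρ)

/-- The probability `Tr ((1 ⊗ E) ρ)` of the effect `E` on `B`. -/
def prob {A B : Type*} [Fintype A] [DecidableEq A] [Fintype B]
    (ρ : Matrix (A × B) (A × B) ℂ) (E : Matrix B B ℂ) : ℝ :=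
  ((((1 : Matrix A A ℂ) ⊗ₖ E) * ρ).trace).re

/-- The average entropy `∑ pᵢ S(ρᵢ)` of the post-measurement states `ρᵢ = Tr_B ((1 ⊗ Eᵢ) ρ) / pᵢ`;
an outcome of probability zero contributes `0`. -/
def avgCondEntropy {A B : Type*} [Fintype A] [DecidableEq A] [Fintype B] [DecidableEq B]
    (ρ : Matrix (A × B) (A × B) ℂ) {k : ℕ} (E : POVM B k) : ℝ :=
  ∑ i, prob ρ (E.effect i) *
    entropy (((prob ρ (E.effect i) : ℂ)⁻¹) • condOp ρ (E.effect i))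

/-- The information gains `S(A) - ∑ pᵢ S(ρᵢ)` over all POVMs on `B`. -/
def gainSet {A B : Type*} [Fintype A] [DecidableEq A] [Fintype B] [DecidableEq B]
    (ρ : Matrix (A × B) (A × B) ℂ) : Set ℝ :=
  {x | ∃ (k : ℕ) (E : POVM B k), x = entropy (traceB ρ) - avgCondEntropy ρ E}

/-- The classical correlation `J(A|B)` (measurement on `B`). -/
def classicalCorr {A B : Type*} [Fintype A] [DecidableEq A] [Fintype B] [DecidableEq B]
    (ρ : Matrix (A × B) (A × B) ℂ) : ℝ :=
  sSup (gainSet ρ)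

/-- The quantum discord `D(A|B) = I(A:B) - J(A|B)` (measurement on `B`). -/
def discord {A B : Type*} [Fintype A] [DecidableEq A] [Fintype B] [DecidableEq B]
    (ρ : Matrix (A × B) (A × B) ℂ) : ℝ :=
  mutualInfo ρ - classicalCorr ρ

/-- The rank one operator `|ψ⟩⟨ψ|`. -/
def ketbra {n : Type*} (ψ : n → ℂ) : Matrix n n ℂ := Matrix.vecMulVec ψ (star ψ)

/-- A pure ensemble `{pᵢ, |ψᵢ⟩}` of `k` unit vectors with `ρ = ∑ pᵢ |ψᵢ⟩⟨ψᵢ|`. -/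
structure PureEnsemble {n : Type*} [Fintype n] (ρ : Matrix n n ℂ) (k : ℕ) where
  weight : Fin k → ℝ
  vec : Fin k → n → ℂ
  weight_nonneg : ∀ i, 0 ≤ weight i
  weight_sum : ∑ i, weight i = 1
  vec_unit : ∀ i, star (vec i) ⬝ᵥ vec i = 1
  decomp : ∑ i, (weight i : ℂ) • ketbra (vec i) = ρ

/-- The average entanglements `∑ pᵢ S(Tr_B |ψᵢ⟩⟨ψᵢ|)` over all pure ensembles of `ρ`. -/
def ensembleSet {A B : Type*} [Fintype A] [DecidableEq A] [Fintype B]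
    (ρ : Matrix (A × B) (A × B) ℂ) : Set ℝ :=
  {x | ∃ (k : ℕ) (e : PureEnsemble ρ k),
    x = ∑ i, e.weight i * entropy (traceB (ketbra (e.vec i)))}

/-- The entanglement of formation `E_F(A:B)`. -/
def entForm {A B : Type*} [Fintype A] [DecidableEq A] [Fintype B]
    (ρ : Matrix (A × B) (A × B) ℂ) : ℝ :=
  sInf (ensembleSet ρ)

/-! The quantities above are well defined: entropy is given by the eigenvalues and is nonnegative
on states, and the two sets are nonempty and bounded on the relevant side. -/

theorem entropy_eq_eigenvalues {n : Type*} [Fintype n] [DecidableEq n] {ρ : Matrix n n ℂ}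
    (h : ρ.IsHermitian) :
    entropy ρ = -∑ i, h.eigenvalues i * Real.logb 2 (h.eigenvalues i) := by
  have hsa : IsSelfAdjoint ρ := h
  have hfin : (spectrum ℝ ρ).Finite := Set.toFinite _
  have e : ρ * cfc (Real.logb 2) ρ = cfc (fun x : ℝ => x * Real.logb 2 x) ρ := by
    rw [cfc_mul (fun x : ℝ => x) (Real.logb 2) ρ (by fun_prop) (hfin.continuousOn _)]
    rw [cfc_id' ℝ ρ]
  rw [entropy, e, h.cfc_eq, Matrix.IsHermitian.cfc]
  rw [Unitary.conjStarAlgAut_apply, Matrix.trace_mul_cycle]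
  simp [Matrix.trace_diagonal]

theorem IsState.entropy_nonneg {n : Type*} [Fintype n] [DecidableEq n] {ρ : Matrix n n ℂ}
    (h : IsState ρ) : 0 ≤ entropy ρ := by
  have hh := h.posSemidef.isHermitian
  rw [entropy_eq_eigenvalues hh, neg_nonneg]
  have hs : ∑ i, hh.eigenvalues i = 1 := by
    have := hh.trace_eq_sum_eigenvalues
    rw [h.trace_eq_one] at this
    exact Complex.ofReal_injective (by simpa using this.symm)
  refine Finset.sum_nonpos fun i _ => ?_
  have h0 := h.posSemidef.eigenvalues_nonneg
  have h1 : hh.eigenvalues i ≤ 1 := by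
    rw [← hs]
    exact Finset.single_le_sum (fun j _ => h0 j) (Finset.mem_univ i)
  refine mul_nonpos_of_nonneg_of_nonpos (h0 i) ?_
  exact Real.logb_nonpos (by norm_num) (h0 i) h1

theorem trace_traceB {A B : Type*} [Fintype A] [Fintype B] (ρ : Matrix (A × B) (A × B) ℂ) :
    (traceB ρ).trace = ρ.trace := by
  simp [Matrix.trace, traceB, Fintype.sum_prod_type]

theorem posSemidef_traceB {A B : Type*} [Fintype A] [Fintype B] {ρ : Matrix (A × B) (A × B) ℂ}
    (h : ρ.PosSemidef) : (traceB ρ).PosSemidef := by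
  have : traceB ρ = ∑ b, ρ.submatrix (fun a => (a, b)) (fun a => (a, b)) := by
    ext a a'
    simp [traceB, Matrix.sum_apply]
  rw [this]
  exact Matrix.posSemidef_sum _ fun b _ => h.submatrix _

theorem traceB_one_kronecker_mul_comm {A B : Type*} [Fintype A] [DecidableEq A] [Fintype B]
    (X : Matrix B B ℂ) (M : Matrix (A × B) (A × B) ℂ) :
    traceB (((1 : Matrix A A ℂ) ⊗ₖ X) * M) = traceB (M * ((1 : Matrix A A ℂ) ⊗ₖ X)) := by
  ext a a'
  have h1 : ∀ b, (((1 : Matrix A A ℂ) ⊗ₖ X) * M) (a, b) (a', b) =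
      ∑ c, X b c * M (a, c) (a', b) := by
    intro b
    rw [Matrix.mul_apply, Fintype.sum_prod_type, Finset.sum_eq_single a]
    · simp
    · intro x _ hx
      simp [hx.symm]
    · simp
  have h2 : ∀ b, (M * ((1 : Matrix A A ℂ) ⊗ₖ X)) (a, b) (a', b) =
      ∑ c, M (a, b) (a', c) * X c b := by
    intro b
    rw [Matrix.mul_apply, Fintype.sum_prod_type, Finset.sum_eq_single a']
    · simp
    · intro x _ hx
      simp [hx]
    · simp
  simp only [traceB, Matrix.of_apply, h1, h2]
  rw [Finset.sum_comm]
  exact Finset.sum_congr rfl fun c _ => Finset.sum_congr rfl fun b _ => mul_comm _ _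

theorem posSemidef_condOp {A B : Type*} [Fintype A] [DecidableEq A] [Fintype B] [DecidableEq B]
    {ρ : Matrix (A × B) (A × B) ℂ} (h : ρ.PosSemidef) {E : Matrix B B ℂ} (hE : E.PosSemidef) :
    (condOp ρ E).PosSemidef := by
  obtain ⟨C, rfl⟩ : ∃ C : Matrix B B ℂ, E = C.conjTranspose * C := by
    open scoped MatrixOrder in
    exact CStarAlgebra.nonneg_iff_eq_star_mul_self.mp hE.nonneg
  have e : (1 : Matrix A A ℂ) ⊗ₖ (C.conjTranspose * C) =
      ((1 : Matrix A A ℂ) ⊗ₖ C.conjTranspose) * ((1 : Matrix A A ℂ) ⊗ₖ C) := by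
    rw [← Matrix.mul_kronecker_mul, one_mul]
  have e2 : (1 : Matrix A A ℂ) ⊗ₖ C.conjTranspose =
      ((1 : Matrix A A ℂ) ⊗ₖ C).conjTranspose := by
    rw [Matrix.conjTranspose_kronecker, Matrix.conjTranspose_one]
  rw [condOp, e, Matrix.mul_assoc, traceB_one_kronecker_mul_comm, e2]
  exact posSemidef_traceB (h.mul_mul_conjTranspose_same _)

theorem prob_nonneg {A B : Type*} [Fintype A] [DecidableEq A] [Fintype B] [DecidableEq B]
    {ρ : Matrix (A × B) (A × B) ℂ} (h : ρ.PosSemidef) {E : Matrix B B ℂ} (hE : E.PosSemidef) :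
    0 ≤ prob ρ E := by
  have := (posSemidef_condOp h hE).trace_nonneg
  rw [condOp, trace_traceB] at this
  exact (Complex.le_def.mp this).1

theorem isState_condOp {A B : Type*} [Fintype A] [DecidableEq A] [Fintype B] [DecidableEq B]
    {ρ : Matrix (A × B) (A × B) ℂ} (h : ρ.PosSemidef) {E : Matrix B B ℂ} (hE : E.PosSemidef)
    (hp : prob ρ E ≠ 0) : IsState (((prob ρ E : ℂ)⁻¹) • condOp ρ E) := by
  have h0 := prob_nonneg h hE
  have ht := (posSemidef_condOp h hE).trace_nonneg
  have hc : (condOp ρ E).trace = (prob ρ E : ℂ) := by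
    apply Complex.ext
    · simp [prob, condOp, trace_traceB]
    · simpa using (Complex.le_def.mp ht).2.symm
  refine ⟨(posSemidef_condOp h hE).smul ?_, ?_⟩
  · rw [← Complex.ofReal_inv]
    exact_mod_cast inv_nonneg.mpr h0
  · rw [Matrix.trace_smul, hc, smul_eq_mul, inv_mul_cancel₀]
    exact_mod_cast hp

theorem gainSet_nonempty {A B : Type*} [Fintype A] [DecidableEq A] [Fintype B] [DecidableEq B]
    (ρ : Matrix (A × B) (A × B) ℂ) : (gainSet ρ).Nonempty :=
  ⟨_, 1, ⟨fun _ => 1, fun _ => Matrix.PosSemidef.one, by simp⟩, rfl⟩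

theorem gainSet_bddAbove {A B : Type*} [Fintype A] [DecidableEq A] [Fintype B] [DecidableEq B]
    {ρ : Matrix (A × B) (A × B) ℂ} (h : IsState ρ) : BddAbove (gainSet ρ) := by
  refine ⟨entropy (traceB ρ), ?_⟩
  rintro x ⟨k, E, rfl⟩
  refine sub_le_self _ (Finset.sum_nonneg fun i _ => ?_)
  by_cases hp : prob ρ (E.effect i) = 0
  · simp [hp]
  · exact mul_nonneg (prob_nonneg h.posSemidef (E.posSemidef i))
      (isState_condOp h.posSemidef (E.posSemidef i) hp).entropy_nonneg

theorem isState_ketbra {n : Type*} [Fintype n] {ψ : n → ℂ} (h : star ψ ⬝ᵥ ψ = 1) :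
    IsState (ketbra ψ) :=
  ⟨Matrix.posSemidef_vecMulVec_self_star ψ, by
    rw [ketbra, Matrix.trace_vecMulVec, dotProduct_comm]; exact h⟩

theorem ensembleSet_bddBelow {A B : Type*} [Fintype A] [DecidableEq A] [Fintype B]
    (ρ : Matrix (A × B) (A × B) ℂ) : BddBelow (ensembleSet ρ) := by
  refine ⟨0, ?_⟩
  rintro x ⟨k, e, rfl⟩
  refine Finset.sum_nonneg fun i _ => mul_nonneg (e.weight_nonneg i) ?_
  have hs := isState_ketbra (e.vec_unit i)
  exact IsState.entropy_nonneg
    ⟨posSemidef_traceB hs.posSemidef, by rw [trace_traceB, hs.trace_eq_one]⟩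

theorem ensembleSet_nonempty {A B : Type*} [Fintype A] [DecidableEq A] [Fintype B]
    {ρ : Matrix (A × B) (A × B) ℂ} (h : IsState ρ) : (ensembleSet ρ).Nonempty := by
  classical
  have hh := h.posSemidef.isHermitian
  let q := (Fintype.equivFin (A × B)).symm
  refine ⟨_, Fintype.card (A × B), ⟨fun i => hh.eigenvalues (q i),
    fun i => ⇑(hh.eigenvectorBasis (q i)), fun i => h.posSemidef.eigenvalues_nonneg _,
    ?_, ?_, ?_⟩, rfl⟩
  · rw [Equiv.sum_comp q]
    have := hh.trace_eq_sum_eigenvalues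
    rw [h.trace_eq_one] at this
    exact Complex.ofReal_injective (by simpa using this.symm)
  · intro i
    have h1 := hh.eigenvectorBasis.orthonormal.1 (q i)
    have h2 := inner_self_eq_norm_sq_to_K (𝕜 := ℂ) (hh.eigenvectorBasis (q i))
    rw [h1, EuclideanSpace.inner_eq_star_dotProduct, dotProduct_comm] at h2
    simpa using h2
  · rw [Equiv.sum_comp q (fun j => (hh.eigenvalues j : ℂ) •
      ketbra (⇑(hh.eigenvectorBasis j)))]
    conv_rhs => rw [hh.spectral_theorem, Unitary.conjStarAlgAut_apply]
    ext x y
    simp only [Matrix.sum_apply, Matrix.smul_apply, ketbra, Matrix.vecMulVec_apply,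
      Matrix.mul_apply, Matrix.diagonal_apply]
    simp
    refine Finset.sum_congr rfl fun j _ => ?_
    ring

end QInfo

end

/-! Purify `ρ = T Tᴴ` by a system `C`, so that `S(C) = S(AB)` and `S(BC) = S(A)`. Condition 2 then
reads `S(BC) = S(B) + S(C)`, the equality case of subadditivity: `B` and `C` are uncorrelated.
Equivalently, every pure effect on `C` leaves `B` in the state `ρ^B`
(`entropy_eq_add_iff_traceA_ketbra_mulVec`).

A resolution of the identity of `C` into rank one operators produces an ensemble of pure states of
`AB`. Since pure states have equal marginal entropies, concavity bounds its average entanglement by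
`S(B)`, and strictness makes the bound tight only if every member has `B`-marginal `ρ^B`. As `E_F`
is an infimum, `E_F = S(B)` forces all these ensembles to be tight, and any unit vector of `C`
occurs in one of them; so `B` and `C` are uncorrelated. Conversely, uncorrelatedness makes every
ensemble average equal to `S(B)` (`entForm_eq_iff`).

The discord equation amounts to `J = S(A) - S(AB)`. By Koashi–Winter duality, rank one measurements
on `B` produce pure ensembles of `AC`, so this is the same statement with `B` and `C` exchanged, and
being uncorrelated is symmetric in `B` and `C` (`classicalCorr_eq_iff`). -/

namespace QInfo

/-! ### Entropy as a function of the characteristic polynomial -/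

-- The multiset of roots ignores the ordering of eigenvalues, so invariances of entropy become
-- identities between characteristic polynomials.
open Matrix Polynomial in
theorem entropy_eq_sum_roots {n : Type*} [Fintype n] [DecidableEq n] {ρ : Matrix n n ℂ}
    (h : ρ.IsHermitian) :
    entropy ρ = -((ρ.charpoly.roots.map fun z => z.re * Real.logb 2 z.re).sum) := by
  rw [entropy_eq_eigenvalues h, h.roots_charpoly_eq_eigenvalues]
  simp

theorem entropy_transpose {n : Type*} [Fintype n] [DecidableEq n] {ρ : Matrix n n ℂ}
    (h : ρ.IsHermitian) : entropy ρ.transpose = entropy ρ := by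
  rw [entropy_eq_sum_roots h, entropy_eq_sum_roots h.transpose, Matrix.charpoly_transpose]

-- The two characteristic polynomials agree up to powers of `X`, and the extra zero roots contribute
-- `0 * logb 2 0 = 0`.
open Matrix Polynomial in
theorem entropy_mul_conjTranspose {m n : Type*} [Fintype m] [DecidableEq m] [Fintype n]
    [DecidableEq n] (M : Matrix m n ℂ) : entropy (M * Mᴴ) = entropy (Mᴴ * M) := by
  rw [entropy_eq_sum_roots (isHermitian_mul_conjTranspose_self M),
    entropy_eq_sum_roots (isHermitian_conjTranspose_mul_self M)]
  have h := congrArg roots (charpoly_mul_comm' M Mᴴ)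
  rw [roots_mul ((monic_X_pow _).mul (charpoly_monic _)).ne_zero,
    roots_mul ((monic_X_pow _).mul (charpoly_monic _)).ne_zero, roots_X_pow, roots_X_pow] at h
  have h2 := congrArg (fun s => (s.map fun z : ℂ => z.re * Real.logb 2 z.re).sum) h
  simpa [Multiset.map_nsmul, Multiset.sum_nsmul] using h2

open Matrix in
theorem entropy_unitary_conj {n : Type*} [Fintype n] [DecidableEq n] {ρ V : Matrix n n ℂ}
    (h : ρ.IsHermitian) (hV : V * Vᴴ = 1) : entropy (Vᴴ * ρ * V) = entropy ρ := by
  rw [entropy_eq_sum_roots h, entropy_eq_sum_roots (isHermitian_conjTranspose_mul_mul V h),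
    charpoly_mul_comm, ← Matrix.mul_assoc, hV, Matrix.one_mul]

open Matrix in
theorem exists_unitary_diagonalization {n : Type*} [Fintype n] [DecidableEq n] {ρ : Matrix n n ℂ}
    (h : ρ.IsHermitian) : ∃ V : Matrix n n ℂ, V * Vᴴ = 1 ∧ Vᴴ * V = 1 ∧
      ρ = V * diagonal (fun k => (h.eigenvalues k : ℂ)) * Vᴴ := by
  refine ⟨h.eigenvectorUnitary, ?_, ?_, ?_⟩
  · exact Unitary.coe_mul_star_self h.eigenvectorUnitary
  · exact Unitary.coe_star_mul_self h.eigenvectorUnitary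
  · conv_lhs => rw [h.spectral_theorem, Unitary.conjStarAlgAut_apply]
    rfl

/-! ### Klein's inequality -/

/-- For `r > 0` the expression is `r * (x - 1 - log x)` with `x = s / r`, which vanishes only at `x
= 1`. -/
theorem sub_le_mul_log_sub_mul_log {r s : ℝ} (hr : 0 ≤ r) (hs : 0 < s) :
    0 ≤ r * Real.log r - r * Real.log s - r + s ∧
      (r * Real.log r - r * Real.log s - r + s = 0 → r = s) := by
  rcases hr.eq_or_lt with rfl | hr
  · simp only [zero_mul, sub_zero, zero_add]
    exact ⟨hs.le, fun h => h.symm⟩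
  · have hx : 0 < s / r := div_pos hs hr
    have e : r * Real.log r - r * Real.log s - r + s
        = r * (s / r - 1 - Real.log (s / r)) := by
      rw [Real.log_div hs.ne' hr.ne']
      field_simp
      ring
    rw [e]
    refine ⟨mul_nonneg hr.le (by linarith [Real.log_le_sub_one_of_pos hx]), fun h => ?_⟩
    by_contra hne
    have h1 : s / r ≠ 1 := fun h' => hne ((div_eq_one_iff_eq hr.ne').mp h').symm
    have h2 := Real.log_lt_sub_one_of_pos hx h1
    have := mul_pos hr (sub_pos.mpr h2)
    linarith

open Matrix in
/-- Klein's inequality relative to a diagonal weight, with its equality case. -/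
theorem entropy_le_of_diagonal {n : Type*} [Fintype n] [DecidableEq n] {N : Matrix n n ℂ}
    (hN : N.PosSemidef) {s : n → ℝ} (hs : ∀ k, 0 ≤ s k) (hsum : ∑ k, s k = N.trace.re)
    (hker : ∀ k, s k = 0 → (N k k).re = 0) :
    entropy N ≤ -∑ k, (N k k).re * Real.logb 2 (s k) ∧
      (entropy N = -∑ k, (N k k).re * Real.logb 2 (s k) →
        N = diagonal fun k => (s k : ℂ)) := by
  obtain ⟨U, hU1, hU2, hU⟩ := exists_unitary_diagonalization hN.isHermitian
  set r := hN.isHermitian.eigenvalues with hr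
  have hr0 : ∀ j, 0 ≤ r j := hN.eigenvalues_nonneg
  have hentry : ∀ k l, N k l = ∑ j, U k j * r j * star (U l j) := by
    intro k l
    conv_lhs => rw [hU]
    rw [Matrix.mul_apply]
    simp [Matrix.mul_diagonal]
  have hdiag : ∀ k, (N k k).re = ∑ j, Complex.normSq (U k j) * r j := by
    intro k
    rw [hentry, Complex.re_sum]
    refine Finset.sum_congr rfl fun j _ => ?_
    rw [mul_right_comm, Complex.star_def, Complex.mul_conj]
    simp
  have hrow : ∀ k, ∑ j, Complex.normSq (U k j) = 1 := by
    intro k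
    have := congrFun (congrFun hU1 k) k
    rw [Matrix.mul_apply] at this
    simp only [conjTranspose_apply, Complex.star_def, Complex.mul_conj, Matrix.one_apply_eq] at this
    exact_mod_cast this
  have hcol : ∀ j, ∑ k, Complex.normSq (U k j) = 1 := by
    intro j
    have := congrFun (congrFun hU2 j) j
    rw [Matrix.mul_apply] at this
    simp only [conjTranspose_apply, Complex.star_def, mul_comm _ (U _ _), Complex.mul_conj,
      Matrix.one_apply_eq] at this
    exact_mod_cast this
  have htr : N.trace.re = ∑ j, r j := by
    rw [hN.isHermitian.trace_eq_sum_eigenvalues]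
    simp [hr]
  have hzero : ∀ k, s k = 0 → ∀ j, Complex.normSq (U k j) * r j = 0 := by
    intro k hk j
    have := hker k hk
    rw [hdiag, Finset.sum_eq_zero_iff_of_nonneg
      fun j _ => mul_nonneg (Complex.normSq_nonneg _) (hr0 j)] at this
    exact this j (Finset.mem_univ j)
  -- The weights `|U k j|²` are doubly stochastic, so these terms sum to the relative entropy, in
  -- natural units, of `N` with respect to the diagonal weight.
  let f : n → n → ℝ := fun k j => Complex.normSq (U k j) *
    (r j * Real.log (r j) - r j * Real.log (s k) - r j + s k)
  have hf : ∀ k j, 0 ≤ f k j ∧ (f k j = 0 → U k j = 0 ∨ r j = s k) := by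
    intro k j
    -- Where `s k = 0` the scalar inequality is unavailable; the support condition gives `U k j = 0`
    -- or `r j = 0 = s k` instead.
    rcases (hs k).eq_or_lt with h0 | h0
    · rcases mul_eq_zero.mp (hzero k h0.symm j) with h1 | h1
      · simp [f, Complex.normSq_eq_zero.mp h1]
      · simp [f, h1, ← h0]
    · have := sub_le_mul_log_sub_mul_log (hr0 j) h0
      refine ⟨mul_nonneg (Complex.normSq_nonneg _) this.1, fun h => ?_⟩
      rcases mul_eq_zero.mp h with h1 | h1
      · exact Or.inl (Complex.normSq_eq_zero.mp h1)
      · exact Or.inr (this.2 h1)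
  have hlog2 : 0 < Real.log 2 := Real.log_pos (by norm_num)
  have hsumf : ∑ k, ∑ j, f k j =
      (-(∑ k, (N k k).re * Real.logb 2 (s k)) - entropy N) * Real.log 2 := by
    have e1 : ∀ k j, f k j = Complex.normSq (U k j) * (r j * Real.log (r j) - r j)
        - Complex.normSq (U k j) * r j * Real.log (s k) + Complex.normSq (U k j) * s k := by
      intro k j; simp only [f]; ring
    simp only [e1, Finset.sum_add_distrib, Finset.sum_sub_distrib]
    have a1 : ∑ k, ∑ j, Complex.normSq (U k j) * (r j * Real.log (r j) - r j) =
        ∑ j, r j * Real.log (r j) - ∑ j, r j := by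
      rw [Finset.sum_comm, ← Finset.sum_sub_distrib]
      simp only [← Finset.sum_mul, hcol, one_mul]
    have a2 : ∑ k, ∑ j, Complex.normSq (U k j) * r j * Real.log (s k) =
        ∑ k, (N k k).re * Real.log (s k) := by
      simp only [← Finset.sum_mul, hdiag]
    have a3 : ∑ k, ∑ j, Complex.normSq (U k j) * s k = ∑ k, s k := by
      simp only [← Finset.sum_mul, hrow, one_mul]
    rw [a1, a2, a3, hsum, htr, entropy_eq_eigenvalues hN.isHermitian, sub_mul, neg_mul, neg_mul,
      Finset.sum_mul, Finset.sum_mul]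
    have c : ∀ x y : ℝ, x * Real.logb 2 y * Real.log 2 = x * Real.log y := by
      intro x y
      rw [Real.logb]; field_simp
    simp only [c, ← hr]
    ring
  refine ⟨?_, fun heq => ?_⟩
  · have : 0 ≤ ∑ k, ∑ j, f k j :=
      Finset.sum_nonneg fun k _ => Finset.sum_nonneg fun j _ => (hf k j).1
    rw [hsumf] at this
    have := nonneg_of_mul_nonneg_left this hlog2
    linarith
  · have h0 : ∑ k, ∑ j, f k j = 0 := by rw [hsumf, heq]; ring
    have h1 : ∀ k j, U k j = 0 ∨ r j = s k := by
      intro k j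
      rw [Finset.sum_eq_zero_iff_of_nonneg
        fun k _ => Finset.sum_nonneg fun j _ => (hf k j).1] at h0
      have := h0 k (Finset.mem_univ k)
      rw [Finset.sum_eq_zero_iff_of_nonneg fun j _ => (hf k j).1] at this
      exact (hf k j).2 (this j (Finset.mem_univ j))
    ext k l
    -- In row `k` each `r j` with `U k j ≠ 0` equals `s k`, so `s k` factors out of the spectral
    -- expansion.
    have h2 : N k l = (s k : ℂ) * (U * Uᴴ) k l := by
      rw [hentry, Matrix.mul_apply, Finset.mul_sum]
      refine Finset.sum_congr rfl fun j _ => ?_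
      rcases h1 k j with h | h
      · simp [h]
      · rw [h, conjTranspose_apply]; ring
    rw [h2, hU1, Matrix.one_apply, Matrix.diagonal_apply]
    split_ifs <;> simp

/-! ### Homogeneous entropy and strict concavity -/

/-- The entropy extended homogeneously to unnormalized states. -/
noncomputable def homEntropy {n : Type*} [Fintype n] [DecidableEq n] (M : Matrix n n ℂ) : ℝ :=
  M.trace.re * entropy ((M.trace.re : ℂ)⁻¹ • M)

theorem homEntropy_zero {n : Type*} [Fintype n] [DecidableEq n] :
    homEntropy (0 : Matrix n n ℂ) = 0 := by
  simp [homEntropy]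

theorem homEntropy_of_trace_eq_one {n : Type*} [Fintype n] [DecidableEq n] {M : Matrix n n ℂ}
    (h : M.trace = 1) : homEntropy M = entropy M := by
  simp [homEntropy, h]

theorem homEntropy_smul {n : Type*} [Fintype n] [DecidableEq n] (M : Matrix n n ℂ) (c : ℝ) :
    homEntropy ((c : ℂ) • M) = c * homEntropy M := by
  by_cases hc : c = 0
  · simp [hc, homEntropy_zero]
  have e : ((((c : ℂ) • M).trace.re : ℝ) : ℂ)⁻¹ • ((c : ℂ) • M) = (M.trace.re : ℂ)⁻¹ • M := by
    rw [smul_smul]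
    congr 1
    have : (c : ℂ) ≠ 0 := by exact_mod_cast hc
    rw [Matrix.trace_smul, smul_eq_mul, Complex.re_ofReal_mul]
    push_cast
    field_simp
  rw [homEntropy, e, homEntropy, Matrix.trace_smul, smul_eq_mul, Complex.re_ofReal_mul, mul_assoc]

theorem homEntropy_smul_of_trace_eq_one {n : Type*} [Fintype n] [DecidableEq n]
    {M : Matrix n n ℂ} (h : M.trace = 1) (c : ℝ) :
    homEntropy ((c : ℂ) • M) = c * entropy M := by
  rw [homEntropy_smul, homEntropy_of_trace_eq_one h]

theorem _root_.Matrix.PosSemidef.ofReal_re_trace {n : Type*} [Fintype n] {M : Matrix n n ℂ}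
    (h : M.PosSemidef) : ((M.trace.re : ℝ) : ℂ) = M.trace := by
  apply Complex.ext
  · simp
  · simpa using (Complex.le_def.mp h.trace_nonneg).2

theorem _root_.Matrix.PosSemidef.re_trace_nonneg {n : Type*} [Fintype n] {M : Matrix n n ℂ}
    (h : M.PosSemidef) : 0 ≤ M.trace.re :=
  (Complex.le_def.mp h.trace_nonneg).1

theorem _root_.Matrix.PosSemidef.eq_zero_of_re_trace {n : Type*} [Fintype n] {M : Matrix n n ℂ}
    (h : M.PosSemidef) (h0 : M.trace.re = 0) : M = 0 := by
  classical
  refine h.trace_eq_zero_iff.mp ?_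
  rw [← h.ofReal_re_trace, h0, Complex.ofReal_zero]

open Matrix in
/-- Klein's inequality in an orthonormal basis, for unnormalized states. -/
theorem homEntropy_le {n : Type*} [Fintype n] [DecidableEq n] {M V : Matrix n n ℂ}
    (hM : M.PosSemidef) (hV : V * Vᴴ = 1) {s : n → ℝ} (hs : ∀ k, 0 ≤ s k)
    (hsum : ∑ k, s k = 1) (hker : ∀ k, s k = 0 → ((Vᴴ * M * V) k k).re = 0) :
    homEntropy M ≤ -∑ k, ((Vᴴ * M * V) k k).re * Real.logb 2 (s k) ∧
      (homEntropy M = -∑ k, ((Vᴴ * M * V) k k).re * Real.logb 2 (s k) →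
        M = M.trace • (V * diagonal (fun k => (s k : ℂ)) * Vᴴ)) := by
  by_cases h0 : M.trace.re = 0
  · have := hM.eq_zero_of_re_trace h0
    subst this
    simp [homEntropy_zero]
  have hpos : 0 < M.trace.re := lt_of_le_of_ne hM.re_trace_nonneg (Ne.symm h0)
  set t := M.trace.re with ht
  have htC : (t : ℂ) ≠ 0 := by exact_mod_cast h0
  have hM' : ((t : ℂ)⁻¹ • M).PosSemidef := hM.smul (by
    rw [← Complex.ofReal_inv]; exact_mod_cast inv_nonneg.mpr hpos.le)
  have e : Vᴴ * ((t : ℂ)⁻¹ • M) * V = (t : ℂ)⁻¹ • (Vᴴ * M * V) := by simp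
  have hre : ∀ k, ((Vᴴ * ((t : ℂ)⁻¹ • M) * V) k k).re = t⁻¹ * ((Vᴴ * M * V) k k).re := by
    intro k
    rw [e, Matrix.smul_apply, smul_eq_mul, ← Complex.ofReal_inv, Complex.re_ofReal_mul]
  have key := entropy_le_of_diagonal (hM'.conjTranspose_mul_mul_same V) hs
    (by
      rw [trace_mul_cycle, hV, Matrix.one_mul, Matrix.trace_smul, hsum, ← hM.ofReal_re_trace,
        ← ht, smul_eq_mul, inv_mul_cancel₀ htC, Complex.one_re])
    (fun k hk => by rw [hre, hker k hk, mul_zero])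
  rw [entropy_unitary_conj hM'.isHermitian hV] at key
  have hs' : ∑ k, ((Vᴴ * ((t : ℂ)⁻¹ • M) * V) k k).re * Real.logb 2 (s k) =
      t⁻¹ * ∑ k, ((Vᴴ * M * V) k k).re * Real.logb 2 (s k) := by
    rw [Finset.mul_sum]
    exact Finset.sum_congr rfl fun k _ => by rw [hre, mul_assoc]
  rw [hs'] at key
  set S := ∑ k, ((Vᴴ * M * V) k k).re * Real.logb 2 (s k)
  have hS : -S = t * -(t⁻¹ * S) := by field_simp
  rw [homEntropy, ← ht]
  refine ⟨?_, fun h => ?_⟩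
  · rw [hS]
    exact mul_le_mul_of_nonneg_left key.1 hpos.le
  · rw [hS] at h
    have h1 := key.2 (mul_left_cancel₀ h0 h)
    rw [← h1, ← hM.ofReal_re_trace, ← ht]
    have : V * (Vᴴ * ((t : ℂ)⁻¹ • M) * V) * Vᴴ = (V * Vᴴ) * ((t : ℂ)⁻¹ • M) * (V * Vᴴ) := by
      simp only [Matrix.mul_assoc]
    rw [this, hV, Matrix.one_mul, Matrix.mul_one, smul_smul, mul_inv_cancel₀ htC, one_smul]

open Matrix in
/-- Strict concavity of the von Neumann entropy. -/
theorem sum_homEntropy_le {ι n : Type*} [Fintype ι] [Fintype n] [DecidableEq n]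
    {M : ι → Matrix n n ℂ} (hM : ∀ i, (M i).PosSemidef) (h1 : (∑ i, M i).trace = 1) :
    ∑ i, homEntropy (M i) ≤ entropy (∑ i, M i) ∧
      (∑ i, homEntropy (M i) = entropy (∑ i, M i) → ∀ i, M i = (M i).trace • ∑ j, M j) := by
  have hS : (∑ i, M i).PosSemidef := posSemidef_sum _ fun i _ => hM i
  obtain ⟨V, hV, hV2, hd⟩ := exists_unitary_diagonalization hS.isHermitian
  set s := hS.isHermitian.eigenvalues
  have hs : ∀ k, 0 ≤ s k := hS.eigenvalues_nonneg
  have hq : ∀ i k, 0 ≤ ((Vᴴ * M i * V) k k).re := fun i k =>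
    (Complex.le_def.mp ((hM i).conjTranspose_mul_mul_same V).diag_nonneg).1
  have hqs : ∀ k, ∑ i, ((Vᴴ * M i * V) k k).re = s k := by
    intro k
    have : Vᴴ * (∑ i, M i) * V = diagonal (fun k => (s k : ℂ)) := by
      rw [hd]
      calc _ = (Vᴴ * V) * diagonal (fun k => (s k : ℂ)) * (Vᴴ * V) := by
            simp only [Matrix.mul_assoc]
        _ = _ := by rw [hV2, Matrix.one_mul, Matrix.mul_one]
    rw [Matrix.mul_sum, Matrix.sum_mul] at this
    have := congrArg Complex.re (congrFun (congrFun this k) k)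
    rw [Matrix.sum_apply, Complex.re_sum] at this
    simpa using this
  have hsum : ∑ k, s k = 1 := by
    have := hS.isHermitian.trace_eq_sum_eigenvalues
    rw [h1] at this
    exact Complex.ofReal_injective (by simpa using this.symm)
  -- All `M i` are compared with the spectral decomposition of their sum. The support condition
  -- holds because the diagonal entries are nonnegative and add up to `s k`.
  have key := fun i => homEntropy_le (hM i) hV hs hsum fun k hk => by
    have := hqs k
    rw [hk, Finset.sum_eq_zero_iff_of_nonneg fun i _ => hq i k] at this
    exact this i (Finset.mem_univ i)
  have htot : ∑ i, -∑ k, ((Vᴴ * M i * V) k k).re * Real.logb 2 (s k) = entropy (∑ i, M i) := by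
    rw [entropy_eq_eigenvalues hS.isHermitian, Finset.sum_neg_distrib, Finset.sum_comm]
    simp only [← Finset.sum_mul, hqs]
    rfl
  refine ⟨htot ▸ Finset.sum_le_sum fun i _ => (key i).1, fun h i => ?_⟩
  -- The bounds add up exactly to the entropy of the sum, so equality holds term by term and Klein's
  -- equality case applies.
  rw [← htot, Finset.sum_eq_sum_iff_of_le fun i _ => (key i).1] at h
  rw [hd]
  exact (key i).2 (h i (Finset.mem_univ i))

/-- Superadditivity of the homogeneous entropy. -/
theorem sum_homEntropy_le_homEntropy_sum {ι n : Type*} [Fintype ι] [Fintype n] [DecidableEq n]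
    {M : ι → Matrix n n ℂ} (hM : ∀ i, (M i).PosSemidef) :
    ∑ i, homEntropy (M i) ≤ homEntropy (∑ i, M i) := by
  have hS : (∑ i, M i).PosSemidef := Matrix.posSemidef_sum _ fun i _ => hM i
  by_cases h0 : (∑ i, M i).trace.re = 0
  · have h0' := h0
    rw [Matrix.trace_sum, Complex.re_sum,
      Finset.sum_eq_zero_iff_of_nonneg fun i _ => (hM i).re_trace_nonneg] at h0'
    rw [hS.eq_zero_of_re_trace h0, homEntropy_zero]
    refine (Finset.sum_eq_zero fun i hi => ?_).le
    rw [(hM i).eq_zero_of_re_trace (h0' i hi), homEntropy_zero]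
  set t := (∑ i, M i).trace.re with ht
  have htC : (t : ℂ) ≠ 0 := by exact_mod_cast h0
  have h0' : 0 ≤ t := hS.re_trace_nonneg
  have key := (sum_homEntropy_le (M := fun i => ((t⁻¹ : ℝ) : ℂ) • M i)
    (fun i => (hM i).smul (by exact_mod_cast inv_nonneg.mpr h0')) (by
      rw [← Finset.smul_sum, Matrix.trace_smul, ← hS.ofReal_re_trace, ← ht, smul_eq_mul,
        Complex.ofReal_inv, inv_mul_cancel₀ htC])).1
  simp only [homEntropy_smul, ← Finset.mul_sum, ← Finset.smul_sum] at key
  have := mul_le_mul_of_nonneg_left key h0'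
  rw [← mul_assoc, mul_inv_cancel₀ h0, one_mul, Complex.ofReal_inv] at this
  exact this

/-! ### Partial traces and equality in subadditivity -/

theorem traceA_eq_traceB_submatrix {A B : Type*} [Fintype A] (M : Matrix (A × B) (A × B) ℂ) :
    traceA M = traceB (M.submatrix Prod.swap Prod.swap) := rfl

section PartialTrace

variable {A B : Type*} [Fintype A] [Fintype B]

open Matrix in
theorem traceB_kronecker_one_mul [DecidableEq B] (X : Matrix A A ℂ)
    (M : Matrix (A × B) (A × B) ℂ) : traceB ((X ⊗ₖ (1 : Matrix B B ℂ)) * M) = X * traceB M := by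
  ext a a'
  simp only [traceB, of_apply, mul_apply, kroneckerMap_apply, Fintype.sum_prod_type, one_apply,
    Finset.mul_sum]
  rw [Finset.sum_comm]
  simp

open Matrix in
theorem traceB_mul_kronecker_one [DecidableEq B] (X : Matrix A A ℂ)
    (M : Matrix (A × B) (A × B) ℂ) : traceB (M * (X ⊗ₖ (1 : Matrix B B ℂ))) = traceB M * X := by
  ext a a'
  simp only [traceB, of_apply, mul_apply, kroneckerMap_apply, Fintype.sum_prod_type, one_apply,
    Finset.sum_mul]
  rw [Finset.sum_comm]
  simp

-- Operators on `B` cycle under the trace over `B` and cancel there, while operators on `A` pass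
-- outside it.
open Matrix in
theorem traceB_kronecker_conj [DecidableEq A] [DecidableEq B] (X X' : Matrix A A ℂ)
    {Y Y' : Matrix B B ℂ} (hY : Y' * Y = 1) (M : Matrix (A × B) (A × B) ℂ) :
    traceB ((X ⊗ₖ Y) * M * (X' ⊗ₖ Y')) = X * traceB M * X' := by
  have e1 : X ⊗ₖ Y = ((1 : Matrix A A ℂ) ⊗ₖ Y) * (X ⊗ₖ (1 : Matrix B B ℂ)) := by
    rw [← mul_kronecker_mul, Matrix.one_mul, Matrix.mul_one]
  have e2 : X' ⊗ₖ Y' = (X' ⊗ₖ (1 : Matrix B B ℂ)) * ((1 : Matrix A A ℂ) ⊗ₖ Y') := by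
    rw [← mul_kronecker_mul, Matrix.one_mul, Matrix.mul_one]
  rw [e1, e2, Matrix.mul_assoc, Matrix.mul_assoc, traceB_one_kronecker_mul_comm]
  simp only [Matrix.mul_assoc]
  rw [← mul_kronecker_mul, Matrix.mul_one, hY, one_kronecker_one, Matrix.mul_one,
    traceB_kronecker_one_mul, traceB_mul_kronecker_one]

open Matrix in
theorem traceA_kronecker_conj [DecidableEq A] [DecidableEq B] {X X' : Matrix A A ℂ}
    (Y Y' : Matrix B B ℂ) (hX : X' * X = 1) (M : Matrix (A × B) (A × B) ℂ) :
    traceA ((X ⊗ₖ Y) * M * (X' ⊗ₖ Y')) = Y * traceA M * Y' := by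
  have hsw : ∀ (Z : Matrix A A ℂ) (W : Matrix B B ℂ),
      (Z ⊗ₖ W).submatrix Prod.swap Prod.swap = W ⊗ₖ Z := by
    intro Z W
    ext ⟨b, a⟩ ⟨b', a'⟩
    simp [mul_comm]
  rw [traceA_eq_traceB_submatrix,
    ← submatrix_mul_equiv _ _ _ (Equiv.prodComm B A) _, ← submatrix_mul_equiv _ _ _
      (Equiv.prodComm B A) _]
  simp only [Equiv.coe_prodComm, hsw]
  rw [traceB_kronecker_conj _ _ hX]
  rfl

theorem trace_traceA (ρ : Matrix (A × B) (A × B) ℂ) : (traceA ρ).trace = ρ.trace := by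
  rw [traceA_eq_traceB_submatrix, trace_traceB]
  exact Equiv.sum_comp (Equiv.prodComm B A) fun x => ρ x x

theorem posSemidef_traceA {ρ : Matrix (A × B) (A × B) ℂ} (h : ρ.PosSemidef) :
    (traceA ρ).PosSemidef :=
  posSemidef_traceB (h.submatrix Prod.swap)

end PartialTrace

/-- The logarithm of the product splits wherever `q` is nonzero, since nonnegativity then makes both
marginals nonzero. This evaluates Klein's bound against a product of marginals. -/
theorem sum_mul_logb_marginals {B C : Type*} [Fintype B] [Fintype C] {q : B × C → ℝ} {s : B → ℝ}
    {t : C → ℝ} (hq : ∀ x, 0 ≤ q x) (hs : ∀ b, ∑ c, q (b, c) = s b)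
    (ht : ∀ c, ∑ b, q (b, c) = t c) :
    ∑ x, q x * Real.logb 2 (s x.1 * t x.2) =
      ∑ b, s b * Real.logb 2 (s b) + ∑ c, t c * Real.logb 2 (t c) := by
  have e : ∀ b c, q (b, c) * Real.logb 2 (s b * t c) =
      q (b, c) * Real.logb 2 (s b) + q (b, c) * Real.logb 2 (t c) := by
    intro b c
    by_cases h0 : q (b, c) = 0
    · simp [h0]
    have hb : s b ≠ 0 := fun h => h0 <| by
      rw [← hs, Finset.sum_eq_zero_iff_of_nonneg fun c _ => hq _] at h
      exact h c (Finset.mem_univ c)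
    have hc : t c ≠ 0 := fun h => h0 <| by
      rw [← ht, Finset.sum_eq_zero_iff_of_nonneg fun c _ => hq _] at h
      exact h b (Finset.mem_univ b)
    rw [Real.logb_mul hb hc, mul_add]
  rw [Fintype.sum_prod_type]
  simp only [e, Finset.sum_add_distrib]
  rw [Finset.sum_comm (f := fun b c => q (b, c) * Real.logb 2 (t c))]
  simp only [← Finset.sum_mul, hs, ht]

open Matrix Polynomial in
theorem entropy_diagonal {n : Type*} [Fintype n] [DecidableEq n] (d : n → ℝ) :
    entropy (diagonal fun k => (d k : ℂ)) = -∑ k, d k * Real.logb 2 (d k) := by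
  have h : (diagonal fun k => (d k : ℂ)).IsHermitian := by
    rw [isHermitian_diagonal_iff]
    intro k
    exact Complex.conj_ofReal _
  have hr : (diagonal fun k => (d k : ℂ)).charpoly.roots =
      Finset.univ.val.map fun k => (d k : ℂ) := by
    rw [charpoly_diagonal]
    have := roots_multiset_prod_X_sub_C (Finset.univ.val.map fun k => (d k : ℂ))
    rwa [Multiset.map_map] at this
  rw [entropy_eq_sum_roots h, hr, Multiset.map_map]
  simp

open Matrix in
/-- The equality case of subadditivity of the von Neumann entropy. -/
theorem entropy_eq_add_iff {B C : Type*} [Fintype B] [DecidableEq B] [Fintype C] [DecidableEq C]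
    {ω : Matrix (B × C) (B × C) ℂ} (hω : IsState ω) :
    entropy ω = entropy (traceB ω) + entropy (traceA ω) ↔ ω = traceB ω ⊗ₖ traceA ω := by
  have hB := posSemidef_traceB hω.posSemidef
  have hC := posSemidef_traceA hω.posSemidef
  obtain ⟨V, hV, hV', hVd⟩ := exists_unitary_diagonalization hB.isHermitian
  obtain ⟨W, hW, hW', hWd⟩ := exists_unitary_diagonalization hC.isHermitian
  have hSB := entropy_eq_eigenvalues hB.isHermitian
  have hSC := entropy_eq_eigenvalues hC.isHermitian
  set s := hB.isHermitian.eigenvalues with hs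
  set t := hC.isHermitian.eigenvalues with ht
  have hs0 : ∀ b, 0 ≤ s b := hB.eigenvalues_nonneg
  have ht0 : ∀ c, 0 ≤ t c := hC.eigenvalues_nonneg
  have hU : (V ⊗ₖ W) * (V ⊗ₖ W)ᴴ = 1 := by
    rw [conjTranspose_kronecker, ← mul_kronecker_mul, hV, hW, one_kronecker_one]
  have hVB : Vᴴ * traceB ω * V = diagonal fun k => (s k : ℂ) := by
    conv_lhs => rw [hVd]
    calc _ = (Vᴴ * V) * diagonal (fun k => (s k : ℂ)) * (Vᴴ * V) := by
          simp only [Matrix.mul_assoc]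
      _ = _ := by rw [hV', Matrix.one_mul, Matrix.mul_one]
  have hWC : Wᴴ * traceA ω * W = diagonal fun k => (t k : ℂ) := by
    conv_lhs => rw [hWd]
    calc _ = (Wᴴ * W) * diagonal (fun k => (t k : ℂ)) * (Wᴴ * W) := by
          simp only [Matrix.mul_assoc]
      _ = _ := by rw [hW', Matrix.one_mul, Matrix.mul_one]
  -- In the product of the eigenbases of the marginals, both marginals are diagonal, though `N`
  -- itself need not be.
  set N := (V ⊗ₖ W)ᴴ * ω * (V ⊗ₖ W) with hN
  have hNB : traceB N = diagonal fun k => (s k : ℂ) := by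
    rw [hN, conjTranspose_kronecker, traceB_kronecker_conj _ _ hW, hVB]
  have hNC : traceA N = diagonal fun k => (t k : ℂ) := by
    rw [hN, conjTranspose_kronecker, traceA_kronecker_conj _ _ hV, hWC]
  have hq : ∀ x, 0 ≤ (N x x).re := fun x =>
    (Complex.le_def.mp (hω.posSemidef.conjTranspose_mul_mul_same (V ⊗ₖ W)).diag_nonneg).1
  have hqs : ∀ b, ∑ c, (N (b, c) (b, c)).re = s b := by
    intro b
    have := congrArg Complex.re (congrFun (congrFun hNB b) b)
    simpa [traceB] using this
  have hqt : ∀ c, ∑ b, (N (b, c) (b, c)).re = t c := by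
    intro c
    have := congrArg Complex.re (congrFun (congrFun hNC c) c)
    simpa [traceA] using this
  have hlog := sum_mul_logb_marginals (q := fun x => (N x x).re) hq hqs hqt
  have hdiag : (V ⊗ₖ W) * diagonal (fun x : B × C => ((s x.1 * t x.2 : ℝ) : ℂ)) * (V ⊗ₖ W)ᴴ =
      traceB ω ⊗ₖ traceA ω := by
    rw [hVd, hWd, mul_kronecker_mul, mul_kronecker_mul, conjTranspose_kronecker,
      diagonal_kronecker_diagonal]
    simp only [Complex.ofReal_mul]
  constructor
  · intro h
    have hsum : ∑ x : B × C, s x.1 * t x.2 = 1 := by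
      have h1 : ∑ b, s b = 1 := by
        have := hB.isHermitian.trace_eq_sum_eigenvalues
        rw [trace_traceB, hω.trace_eq_one] at this
        exact Complex.ofReal_injective (by simpa using this.symm)
      have h2 : ∑ c, t c = 1 := by
        have := hC.isHermitian.trace_eq_sum_eigenvalues
        rw [trace_traceA, hω.trace_eq_one] at this
        exact Complex.ofReal_injective (by simpa using this.symm)
      rw [Fintype.sum_prod_type]
      simp only [← Finset.mul_sum, h2, mul_one, h1]
    -- Klein's inequality relative to the product of the marginals; a zero of either marginal kills
    -- the corresponding diagonal entries of `N`.
    have key := (homEntropy_le hω.posSemidef hU (s := fun x => s x.1 * t x.2)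
      (fun x => mul_nonneg (hs0 _) (ht0 _)) hsum (by
        rintro ⟨b, c⟩ hx
        rcases mul_eq_zero.mp hx with h0 | h0
        · simp only at h0
          rw [← hqs, Finset.sum_eq_zero_iff_of_nonneg fun c _ => hq _] at h0
          exact h0 c (Finset.mem_univ c)
        · simp only at h0
          rw [← hqt, Finset.sum_eq_zero_iff_of_nonneg fun c _ => hq _] at h0
          exact h0 b (Finset.mem_univ b))).2
    rw [homEntropy_of_trace_eq_one hω.trace_eq_one, hω.trace_eq_one, one_smul, hdiag] at key
    refine key ?_
    rw [← hN, hlog, h, hSB, hSC]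
    ring
  · intro h
    have hN' : N = diagonal (fun x : B × C => ((s x.1 * t x.2 : ℝ) : ℂ)) := by
      rw [hN]
      conv_lhs => rw [h]
      rw [conjTranspose_kronecker, ← mul_kronecker_mul, ← mul_kronecker_mul, hVB, hWC,
        diagonal_kronecker_diagonal]
      simp only [Complex.ofReal_mul]
    have hent : entropy N = entropy ω := entropy_unitary_conj hω.posSemidef.isHermitian hU
    have hqq : ∀ x, (N x x).re = s x.1 * t x.2 := by
      intro x
      rw [hN', diagonal_apply_eq, Complex.ofReal_re]
    rw [← hent, hN', entropy_diagonal, hSB, hSC]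
    simp only [hqq] at hlog
    rw [hlog]
    ring

/-! ### Rank one operators and marginals of pure states -/

open Matrix in
theorem ketbra_mulVec {m n : Type*} [Fintype n] (T : Matrix m n ℂ) (y : n → ℂ) :
    ketbra (T *ᵥ y) = T * ketbra y * Tᴴ := by
  rw [ketbra, ketbra, star_mulVec, mul_vecMulVec, vecMulVec_mul]

theorem ketbra_smul {n : Type*} (c : ℂ) (ψ : n → ℂ) :
    ketbra (c • ψ) = ((Complex.normSq c : ℝ) : ℂ) • ketbra ψ := by
  ext i j
  simp only [ketbra, Matrix.vecMulVec_apply, Pi.smul_apply, Pi.star_apply, Matrix.smul_apply,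
    smul_eq_mul, star_mul', Complex.star_def, ← Complex.mul_conj]
  ring

theorem posSemidef_ketbra {n : Type*} [Finite n] (ψ : n → ℂ) : (ketbra ψ).PosSemidef :=
  Matrix.posSemidef_vecMulVec_self_star ψ

open Matrix in
theorem sum_ketbra_col {m n : Type*} [Fintype n] (T : Matrix m n ℂ) :
    ∑ j, ketbra (fun i => T i j) = T * Tᴴ := by
  ext i i'
  simp [Matrix.sum_apply, ketbra, vecMulVec_apply, mul_apply]

theorem traceA_smul {A B : Type*} [Fintype A] (c : ℂ) (M : Matrix (A × B) (A × B) ℂ) :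
    traceA (c • M) = c • traceA M := by
  ext i j
  simp [traceA, Finset.mul_sum]

theorem traceB_smul {A B : Type*} [Fintype B] (c : ℂ) (M : Matrix (A × B) (A × B) ℂ) :
    traceB (c • M) = c • traceB M := by
  ext i j
  simp [traceB, Finset.mul_sum]

theorem traceA_sum {ι A B : Type*} [Fintype ι] [Fintype A]
    (M : ι → Matrix (A × B) (A × B) ℂ) : traceA (∑ i, M i) = ∑ i, traceA (M i) := by
  ext a b
  simp only [traceA, Matrix.of_apply, Matrix.sum_apply]
  exact Finset.sum_comm

theorem traceB_sum {ι A B : Type*} [Fintype ι] [Fintype B]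
    (M : ι → Matrix (A × B) (A × B) ℂ) : traceB (∑ i, M i) = ∑ i, traceB (M i) := by
  ext a b
  simp only [traceB, Matrix.of_apply, Matrix.sum_apply]
  exact Finset.sum_comm

open Matrix in
/-- The two marginals of a pure state have the same entropy. -/
theorem homEntropy_traceB_ketbra {A B : Type*} [Fintype A] [DecidableEq A] [Fintype B]
    [DecidableEq B] (φ : A × B → ℂ) :
    homEntropy (traceB (ketbra φ)) = homEntropy (traceA (ketbra φ)) := by
  -- The coefficient matrix of `φ`: its marginals are `P Pᴴ` and `(Pᴴ P)ᵀ`, which share their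
  -- nonzero spectrum.
  let P : Matrix A B ℂ := of fun a b => φ (a, b)
  have h1 : traceB (ketbra φ) = P * Pᴴ := by
    ext a a'
    simp [traceB, ketbra, vecMulVec_apply, mul_apply, P]
  have h2 : traceA (ketbra φ) = (Pᴴ * P)ᵀ := by
    ext a a'
    simp [traceA, ketbra, vecMulVec_apply, mul_apply, P, mul_comm]
  have ht : (traceB (ketbra φ)).trace = (traceA (ketbra φ)).trace := by
    rw [trace_traceB, trace_traceA]
  have ht0 : 0 ≤ (traceA (ketbra φ)).trace.re :=
    (posSemidef_traceA (posSemidef_ketbra φ)).re_trace_nonneg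
  rw [homEntropy, homEntropy, ht]
  generalize (traceA (ketbra φ)).trace.re = t at ht0
  congr 1
  -- Splitting the normalization into two square roots absorbs it into `P`; `t = 0` is covered by
  -- `0⁻¹ = 0`.
  have hd : (t : ℂ)⁻¹ = (Real.sqrt t⁻¹ : ℂ) * (Real.sqrt t⁻¹ : ℂ) := by
    rw [← Complex.ofReal_mul, Real.mul_self_sqrt (inv_nonneg.mpr ht0), Complex.ofReal_inv]
  have e1 : (t : ℂ)⁻¹ • (P * Pᴴ) = ((Real.sqrt t⁻¹ : ℂ) • P) * ((Real.sqrt t⁻¹ : ℂ) • P)ᴴ := by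
    rw [conjTranspose_smul, Complex.star_def, Complex.conj_ofReal, Matrix.smul_mul,
      Matrix.mul_smul, smul_smul, hd]
  have e2 : (t : ℂ)⁻¹ • (Pᴴ * P)ᵀ =
      (((Real.sqrt t⁻¹ : ℂ) • P)ᴴ * ((Real.sqrt t⁻¹ : ℂ) • P))ᵀ := by
    rw [conjTranspose_smul, Complex.star_def, Complex.conj_ofReal, Matrix.smul_mul,
      Matrix.mul_smul, smul_smul, hd, transpose_smul]
  rw [h1, h2, e1, e2, entropy_transpose (isHermitian_conjTranspose_mul_self _),
    entropy_mul_conjTranspose]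

/-! ### Purification and uncorrelated systems -/

-- Polarization over `ℂ`: an operator with `⟪T x, x⟫ = 0` for all `x` vanishes, with no Hermitian
-- assumption.
open Matrix in
theorem eq_zero_of_quadratic_form_eq_zero {n : Type*} [Fintype n] {F : Matrix n n ℂ}
    (h : ∀ y : n → ℂ, ∑ i, ∑ j, F i j * (y i * star (y j)) = 0) : F = 0 := by
  classical
  have hT : toEuclideanLin Fᵀ = 0 := by
    rw [← inner_map_self_eq_zero]
    intro x
    have := congrArg star (h x)
    rw [EuclideanSpace.inner_eq_star_dotProduct]
    simp only [star_sum, star_mul', star_zero, star_star] at this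
    rw [← this, Finset.sum_comm]
    simp [dotProduct, mulVec, Finset.mul_sum]
    refine Finset.sum_congr rfl fun i _ => Finset.sum_congr rfl fun j _ => ?_
    ring
  have := (LinearEquiv.map_eq_zero_iff _).mp hT
  exact transpose_eq_zero.mp this

open Matrix in
/-- Let `C` purify the state `ρ = T Tᴴ` of `AB`. Then `S(A) = S(B) + S(AB)` if and only if `B` and
`C` are uncorrelated, that is, the state of `B` is unaffected by every pure effect on `C`. -/
theorem entropy_eq_add_iff_traceA_ketbra_mulVec {A B C : Type*} [Fintype A] [DecidableEq A]
    [Fintype B] [DecidableEq B] [Fintype C] [DecidableEq C] (T : Matrix (A × B) C ℂ)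
    (hρ : IsState (T * Tᴴ)) :
    entropy (traceB (T * Tᴴ)) = entropy (traceA (T * Tᴴ)) + entropy (T * Tᴴ) ↔
      ∀ y : C → ℂ, traceA (ketbra (T *ᵥ y)) = (ketbra (T *ᵥ y)).trace • traceA (T * Tᴴ) := by
  -- The same tripartite vector with its indices regrouped, so that `X Xᴴ` is the state of `BC`.
  let X : Matrix (B × C) A ℂ := of fun x a => T (a, x.1) x.2
  have hB : traceB (X * Xᴴ) = traceA (T * Tᴴ) := by
    ext b b'
    simp only [traceA, traceB, of_apply, mul_apply, conjTranspose_apply, X]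
    exact Finset.sum_comm
  have hC : traceA (X * Xᴴ) = (Tᴴ * T)ᵀ := by
    ext c c'
    simp only [traceA, of_apply, mul_apply, conjTranspose_apply, X, transpose_apply,
      Fintype.sum_prod_type]
    rw [Finset.sum_comm]
    simp only [mul_comm]
  have hA : (Xᴴ * X)ᵀ = traceB (T * Tᴴ) := by
    ext a a'
    simp only [traceB, of_apply, mul_apply, conjTranspose_apply, X, transpose_apply,
      Fintype.sum_prod_type, mul_comm]
  have hω : IsState (X * Xᴴ) := by
    refine ⟨posSemidef_self_mul_conjTranspose X, ?_⟩
    rw [← trace_traceB, hB, trace_traceA, hρ.trace_eq_one]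
  have hSA : entropy (X * Xᴴ) = entropy (traceB (T * Tᴴ)) := by
    rw [← hA, entropy_transpose (isHermitian_conjTranspose_mul_self X),
      entropy_mul_conjTranspose]
  have hSC : entropy (traceA (X * Xᴴ)) = entropy (T * Tᴴ) := by
    rw [hC, entropy_transpose (isHermitian_conjTranspose_mul_self T), entropy_mul_conjTranspose]
  rw [← hSA, ← hSC, ← hB, entropy_eq_add_iff hω]
  have hket : ∀ y b b', traceA (ketbra (T *ᵥ y)) b b' =
      ∑ c, ∑ c', (X * Xᴴ) (b, c) (b', c') * (y c * star (y c')) := by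
    intro y b b'
    simp only [traceA, ketbra, of_apply, vecMulVec_apply, Pi.star_apply, mulVec, dotProduct,
      mul_apply, conjTranspose_apply, X, star_sum, Finset.sum_mul_sum]
    rw [Finset.sum_comm]
    refine Finset.sum_congr rfl fun c _ => ?_
    rw [Finset.sum_comm]
    refine Finset.sum_congr rfl fun c' _ => ?_
    rw [Finset.sum_mul]
    refine Finset.sum_congr rfl fun a _ => ?_
    rw [star_mul']
    ring
  have htr : ∀ y, (ketbra (T *ᵥ y)).trace =
      ∑ c, ∑ c', traceA (X * Xᴴ) c c' * (y c * star (y c')) := by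
    intro y
    have : (traceA (ketbra (T *ᵥ y))).trace =
        ∑ b, ∑ c, ∑ c', (X * Xᴴ) (b, c) (b, c') * (y c * star (y c')) :=
      Finset.sum_congr rfl fun b _ => hket y b b
    rw [← trace_traceA, this, Finset.sum_comm]
    refine Finset.sum_congr rfl fun c _ => ?_
    rw [Finset.sum_comm]
    exact Finset.sum_congr rfl fun c' _ => (Finset.sum_mul _ _ _).symm
  constructor
  · intro h y
    ext b b'
    rw [hket, htr, Matrix.smul_apply, smul_eq_mul, Finset.sum_mul]
    refine Finset.sum_congr rfl fun c _ => ?_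
    rw [Finset.sum_mul]
    refine Finset.sum_congr rfl fun c' _ => ?_
    have := congrFun (congrFun h (b, c)) (b', c')
    rw [this, kroneckerMap_apply]
    ring
  · intro h
    ext ⟨b, c⟩ ⟨b', c'⟩
    -- For fixed `b` and `b'`, the hypothesis says that the quadratic form of this block on `C`
    -- vanishes.
    have key : (of fun c c' => (X * Xᴴ) (b, c) (b', c') -
        traceB (X * Xᴴ) b b' * traceA (X * Xᴴ) c c' : Matrix C C ℂ) = 0 := by
      refine eq_zero_of_quadratic_form_eq_zero fun y => ?_
      have h1 := congrFun (congrFun (h y) b) b'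
      rw [hket, htr, Matrix.smul_apply, smul_eq_mul, ← sub_eq_zero] at h1
      rw [← h1, Finset.sum_mul, ← Finset.sum_sub_distrib]
      refine Finset.sum_congr rfl fun c _ => ?_
      rw [Finset.sum_mul, ← Finset.sum_sub_distrib]
      refine Finset.sum_congr rfl fun c' _ => ?_
      rw [of_apply]
      ring
    have := congrFun (congrFun key c) c'
    rw [kroneckerMap_apply]
    exact sub_eq_zero.mp this

/-! ### Rank one resolutions and the equality case of concavity -/

open Matrix in
/-- Every unit vector belongs to a resolution of the identity into rank one operators. -/
theorem exists_sum_ketbra_eq_one {C : Type*} [Fintype C] [DecidableEq C] {y : C → ℂ}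
    (hy : star y ⬝ᵥ y = 1) :
    ∃ v : Option C → C → ℂ, v none = y ∧ ∑ i, ketbra (v i) = 1 := by
  have hid : ketbra y * ketbra y = ketbra y := by
    rw [ketbra, vecMulVec_mul_vecMulVec, hy, one_smul]
  -- The remaining vectors are the columns of the projection `Q = 1 - |y⟩⟨y|`, whose rank one
  -- operators sum to `Q Qᴴ = Q`.
  refine ⟨fun i => i.elim y fun c d => (1 - ketbra y) d c, rfl, ?_⟩
  rw [Fintype.sum_option]
  simp only [Option.elim_none, Option.elim_some]
  rw [sum_ketbra_col, conjTranspose_sub, conjTranspose_one,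
    (posSemidef_ketbra y).isHermitian.eq, sub_mul, mul_sub, mul_sub, hid]
  simp

/-- It suffices to verify the invariance of the marginal on unit vectors. -/
theorem traceA_ketbra_mulVec_of_unit {A B C : Type*} [Fintype A] [Fintype B] [Fintype C]
    {T : Matrix (A × B) C ℂ} {σ : Matrix B B ℂ}
    (h : ∀ y : C → ℂ, star y ⬝ᵥ y = 1 →
      traceA (ketbra (T.mulVec y)) = (ketbra (T.mulVec y)).trace • σ) (y : C → ℂ) :
    traceA (ketbra (T.mulVec y)) = (ketbra (T.mulVec y)).trace • σ := by
  by_cases h0 : y = 0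
  · subst h0
    have : ketbra (T.mulVec 0) = 0 := by simp [ketbra]
    rw [this]
    ext
    simp [traceA]
  have hpos : 0 < star y ⬝ᵥ y := Matrix.dotProduct_star_self_pos_iff.mpr h0
  obtain ⟨hr, hi⟩ := Complex.lt_def.mp hpos
  set r := (star y ⬝ᵥ y).re with hrdef
  have hr' : 0 < r := hr
  have hyr : star y ⬝ᵥ y = (r : ℂ) := Complex.ext (by simp [hrdef]) (by simpa using hi.symm)
  have hsq : (Real.sqrt r : ℂ) ≠ 0 := by
    exact_mod_cast (Real.sqrt_pos.mpr hr').ne'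
  have hy : y = (Real.sqrt r : ℂ) • ((Real.sqrt r : ℂ)⁻¹ • y) := by
    rw [smul_smul, mul_inv_cancel₀ hsq, one_smul]
  have hu := h ((Real.sqrt r : ℂ)⁻¹ • y) (by
    rw [star_smul, smul_dotProduct, dotProduct_smul, hyr, ← Complex.ofReal_inv,
      Complex.star_def, Complex.conj_ofReal, smul_eq_mul, smul_eq_mul]
    norm_cast
    rw [← mul_assoc, ← mul_inv, Real.mul_self_sqrt hr'.le, inv_mul_cancel₀ hr'.ne'])
  rw [hy, Matrix.mulVec_smul, ketbra_smul, traceA_smul, hu, Matrix.trace_smul, smul_assoc]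

theorem homEntropy_trace_smul {m n : Type*} [Fintype m] [Fintype n] [DecidableEq n]
    {K : Matrix m m ℂ} (hK : K.PosSemidef) {σ : Matrix n n ℂ} (hσ : σ.trace = 1) :
    homEntropy (K.trace • σ) = K.trace.re * entropy σ := by
  rw [← hK.ofReal_re_trace, homEntropy_smul_of_trace_eq_one hσ, Complex.ofReal_re]

open Matrix in
/-- If every resolution of the identity of `C` into rank one operators yields an ensemble of pure
states of `AB` with average entanglement at least `S(B)`, then `B` is unaffected by effects on
`C`. -/
theorem traceA_ketbra_mulVec_of_le {A B C : Type*} [Fintype A] [DecidableEq A]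
    [Fintype B] [DecidableEq B] [Fintype C] [DecidableEq C] {T : Matrix (A × B) C ℂ}
    (hρ : IsState (T * Tᴴ))
    (h : ∀ v : Option C → C → ℂ, ∑ i, ketbra (v i) = 1 →
      entropy (traceA (T * Tᴴ)) ≤ ∑ i, homEntropy (traceB (ketbra (T *ᵥ v i)))) (y : C → ℂ) :
    traceA (ketbra (T *ᵥ y)) = (ketbra (T *ᵥ y)).trace • traceA (T * Tᴴ) := by
  revert y
  refine traceA_ketbra_mulVec_of_unit fun y hy => ?_
  obtain ⟨v, hv, hsum⟩ := exists_sum_ketbra_eq_one hy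
  have hT : ∑ i, traceA (ketbra (T *ᵥ v i)) = traceA (T * Tᴴ) := by
    simp only [← traceA_sum, ketbra_mulVec, ← Matrix.sum_mul, ← Matrix.mul_sum, hsum,
      Matrix.mul_one]
  have hle := h v hsum
  simp only [homEntropy_traceB_ketbra] at hle
  have key := sum_homEntropy_le (M := fun i => traceA (ketbra (T *ᵥ v i)))
    (fun i => posSemidef_traceA (posSemidef_ketbra _))
    (by rw [hT, trace_traceA, hρ.trace_eq_one])
  simp only [hT] at key
  -- Concavity gives the opposite inequality; its equality case is read off at the slot `none`,
  -- occupied by `y`.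
  have := key.2 (le_antisymm key.1 hle) none
  rwa [hv, trace_traceA] at this

/-! ### Entanglement of formation -/

/-- Unnormalized vectors serve as ensembles: squared norms become the weights, and a null vector is
replaced by an arbitrary unit vector of weight `0`. -/
theorem sum_homEntropy_mem_ensembleSet {ι A B : Type*} [Fintype ι] [Fintype A] [DecidableEq A]
    [Fintype B] [DecidableEq B] {ρ : Matrix (A × B) (A × B) ℂ} (hρ : ρ.trace = 1)
    {v : ι → A × B → ℂ} (hv : ∑ i, ketbra (v i) = ρ) :
    ∑ i, homEntropy (traceB (ketbra (v i))) ∈ ensembleSet ρ := by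
  obtain ⟨x₀⟩ : Nonempty (A × B) := by
    by_contra hne
    rw [not_nonempty_iff] at hne
    simp [Matrix.trace] at hρ
  let w : ι → ℝ := fun i => (ketbra (v i)).trace.re
  have hw : ∀ i, 0 ≤ w i := fun i => (posSemidef_ketbra (v i)).re_trace_nonneg
  have hunit : ∀ i, ∃ u : A × B → ℂ, star u ⬝ᵥ u = 1 ∧ (w i : ℂ) • ketbra u = ketbra (v i) := by
    intro i
    by_cases h0 : w i = 0
    · refine ⟨Pi.single x₀ 1, by simp, ?_⟩
      rw [h0, (posSemidef_ketbra (v i)).eq_zero_of_re_trace h0, Complex.ofReal_zero, zero_smul]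
    · have hpos : 0 < w i := lt_of_le_of_ne (hw i) (Ne.symm h0)
      have hk : (w i : ℂ) • ketbra ((Real.sqrt (w i)⁻¹ : ℂ) • v i) = ketbra (v i) := by
        rw [ketbra_smul, smul_smul, Complex.normSq_ofReal,
          Real.mul_self_sqrt (inv_nonneg.mpr hpos.le), ← Complex.ofReal_mul,
          mul_inv_cancel₀ h0, Complex.ofReal_one, one_smul]
      refine ⟨(Real.sqrt (w i)⁻¹ : ℂ) • v i, ?_, hk⟩
      have h1 : (w i : ℂ) * (ketbra ((Real.sqrt (w i)⁻¹ : ℂ) • v i)).trace = w i := by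
        rw [← smul_eq_mul, ← Matrix.trace_smul, hk, (posSemidef_ketbra (v i)).ofReal_re_trace]
      have h2 := mul_left_cancel₀ (by exact_mod_cast h0) (h1.trans (mul_one _).symm)
      rwa [ketbra, Matrix.trace_vecMulVec, dotProduct_comm] at h2
  choose u hu1 hu2 using hunit
  let q := (Fintype.equivFin ι).symm
  refine ⟨Fintype.card ι, ⟨fun j => w (q j), fun j => u (q j), fun j => hw _, ?_, fun j => hu1 _,
    ?_⟩, ?_⟩
  · rw [Equiv.sum_comp q]
    simp only [w]
    rw [← Complex.re_sum, ← Matrix.trace_sum, hv, hρ, Complex.one_re]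
  · rw [Equiv.sum_comp q fun i => (w i : ℂ) • ketbra (u i), ← hv]
    exact Finset.sum_congr rfl fun i _ => hu2 i
  · rw [Equiv.sum_comp q fun i => w i * entropy (traceB (ketbra (u i)))]
    refine Finset.sum_congr rfl fun i _ => ?_
    rw [← hu2 i, traceB_smul, homEntropy_smul_of_trace_eq_one]
    rw [trace_traceB, (isState_ketbra (hu1 i)).trace_eq_one]

open Matrix in
theorem _root_.Matrix.PosSemidef.exists_eq_mul_conjTranspose {n : Type*} [Fintype n]
    [DecidableEq n] {M : Matrix n n ℂ} (h : M.PosSemidef) : ∃ F : Matrix n n ℂ, M = F * Fᴴ := by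
  obtain ⟨F, hF⟩ : ∃ F : Matrix n n ℂ, M = star F * F := by
    open scoped MatrixOrder in
    exact CStarAlgebra.nonneg_iff_eq_star_mul_self.mp h.nonneg
  exact ⟨Fᴴ, by rw [conjTranspose_conjTranspose]; exact hF⟩

-- Forwards, the infimum bounds below every ensemble induced by a rank one resolution on the
-- purifying system, so concavity is saturated. Backwards, uncorrelatedness collapses `ensembleSet
-- ρ` to one point.
open Matrix in
theorem entForm_eq_iff {A B : Type*} [Fintype A] [DecidableEq A] [Fintype B] [DecidableEq B]
    {ρ : Matrix (A × B) (A × B) ℂ} (hρ : IsState ρ) :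
    entForm ρ = entropy (traceA ρ) ↔
      entropy (traceB ρ) = entropy (traceA ρ) + entropy ρ := by
  constructor
  · intro h
    obtain ⟨T, rfl⟩ := hρ.posSemidef.exists_eq_mul_conjTranspose
    rw [entropy_eq_add_iff_traceA_ketbra_mulVec T hρ]
    refine traceA_ketbra_mulVec_of_le hρ fun v hv => ?_
    rw [← h]
    refine csInf_le (ensembleSet_bddBelow _)
      (sum_homEntropy_mem_ensembleSet hρ.trace_eq_one ?_)
    simp only [ketbra_mulVec, ← Matrix.sum_mul, ← Matrix.mul_sum, hv, Matrix.mul_one]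
  · intro h
    have hval : ∀ x ∈ ensembleSet ρ, x = entropy (traceA ρ) := by
      rintro x ⟨k, e, rfl⟩
      -- Each ensemble gives its own purification, with purifying system `Fin k`; its members are
      -- the images of the basis vectors.
      let T : Matrix (A × B) (Fin k) ℂ := of fun x i => (Real.sqrt (e.weight i) : ℂ) * e.vec i x
      have hcol : ∀ i, ketbra (fun x => T x i) = (e.weight i : ℂ) • ketbra (e.vec i) := by
        intro i
        have : (fun x => T x i) = (Real.sqrt (e.weight i) : ℂ) • e.vec i := rfl
        rw [this, ketbra_smul, Complex.normSq_ofReal, Real.mul_self_sqrt (e.weight_nonneg i)]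
      have hT : T * Tᴴ = ρ := by
        rw [← sum_ketbra_col, ← e.decomp]
        exact Finset.sum_congr rfl fun i _ => hcol i
      have hcore := entropy_eq_add_iff_traceA_ketbra_mulVec T (by rw [hT]; exact hρ)
      rw [hT] at hcore
      replace h := hcore.mp h
      have hi : ∀ i, e.weight i * entropy (traceB (ketbra (e.vec i))) =
          e.weight i * entropy (traceA ρ) := by
        intro i
        have h1 := (isState_ketbra (e.vec_unit i)).trace_eq_one
        have h2 := h (Pi.single i 1)
        have h3 : T *ᵥ Pi.single i 1 = fun x => T x i := by
          rw [mulVec_single_one]; rfl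
        have h4 := homEntropy_traceB_ketbra (fun x => T x i)
        rw [h3] at h2
        rw [h2, homEntropy_trace_smul (posSemidef_ketbra _)
          (by rw [trace_traceA, hρ.trace_eq_one]), hcol, traceB_smul,
          homEntropy_smul_of_trace_eq_one (by rw [trace_traceB, h1]), trace_smul, h1, smul_eq_mul,
          mul_one, Complex.ofReal_re] at h4
        exact h4
      simp only [hi, ← Finset.sum_mul, e.weight_sum, one_mul]
    obtain ⟨x, hx⟩ := ensembleSet_nonempty hρ
    have : ensembleSet ρ = {entropy (traceA ρ)} :=
      Set.eq_singleton_iff_unique_mem.mpr ⟨hval x hx ▸ hx, hval⟩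
    rw [entForm, this, csInf_singleton]

/-! ### Classical correlation and the exchange of `B` with `C` -/

theorem avgCondEntropy_eq_sum_homEntropy {A B : Type*} [Fintype A] [DecidableEq A] [Fintype B]
    [DecidableEq B] (ρ : Matrix (A × B) (A × B) ℂ) {k : ℕ} (E : POVM B k) :
    avgCondEntropy ρ E = ∑ i, homEntropy (condOp ρ (E.effect i)) := by
  refine Finset.sum_congr rfl fun i _ => ?_
  rw [homEntropy, condOp, trace_traceB]
  rfl

open Matrix in
theorem condOp_sum {ι A B : Type*} [Fintype ι] [Fintype A] [DecidableEq A] [Fintype B]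
    (ρ : Matrix (A × B) (A × B) ℂ) (E : ι → Matrix B B ℂ) :
    condOp ρ (∑ i, E i) = ∑ i, condOp ρ (E i) := by
  have : (1 : Matrix A A ℂ) ⊗ₖ (∑ i, E i) = ∑ i, (1 : Matrix A A ℂ) ⊗ₖ E i := by
    ext ⟨a, b⟩ ⟨a', b'⟩
    simp [kroneckerMap_apply, Matrix.sum_apply, Finset.mul_sum]
  simp only [condOp]
  rw [this, Matrix.sum_mul, traceB_sum]

open Matrix in
theorem sum_re_trace_condOp {ι A B : Type*} [Fintype ι] [Fintype A] [DecidableEq A] [Fintype B]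
    [DecidableEq B] {ρ : Matrix (A × B) (A × B) ℂ} (hρ : IsState ρ) {E : ι → Matrix B B ℂ}
    (hE : ∑ i, E i = 1) : ∑ i, (condOp ρ (E i)).trace.re = 1 := by
  rw [← Complex.re_sum, ← trace_sum, ← condOp_sum, hE, condOp, one_kronecker_one,
    Matrix.one_mul, trace_traceB, hρ.trace_eq_one, Complex.one_re]

theorem sub_sum_homEntropy_condOp_mem_gainSet {ι A B : Type*} [Fintype ι] [Fintype A]
    [DecidableEq A] [Fintype B] [DecidableEq B] (ρ : Matrix (A × B) (A × B) ℂ) {E : ι → Matrix B B ℂ}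
    (hE : ∀ i, (E i).PosSemidef) (h1 : ∑ i, E i = 1) :
    entropy (traceB ρ) - ∑ i, homEntropy (condOp ρ (E i)) ∈ gainSet ρ := by
  let q := (Fintype.equivFin ι).symm
  refine ⟨Fintype.card ι, ⟨fun j => E (q j), fun j => hE _, ?_⟩, ?_⟩
  · rw [Equiv.sum_comp q, h1]
  · rw [avgCondEntropy_eq_sum_homEntropy,
      Equiv.sum_comp q fun i => homEntropy (condOp ρ (E i))]

/-- Exchange of the system `B` with the purifying system `C`. -/
def swapPurification {A B C : Type*} (T : Matrix (A × B) C ℂ) : Matrix (A × C) B ℂ :=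
  Matrix.of fun x b => T (x.1, b) x.2

-- The Koashi–Winter step: a rank one effect on `B` leaves `AC` in a pure state, obtained by
-- contracting the purification with the conjugate of `x`.
open Matrix in
theorem condOp_ketbra {A B C : Type*} [Fintype A] [DecidableEq A] [Fintype B] [DecidableEq B]
    [Fintype C] (T : Matrix (A × B) C ℂ) (x : B → ℂ) :
    condOp (T * Tᴴ) (ketbra x) = traceB (ketbra (swapPurification T *ᵥ star x)) := by
  ext a a'
  have h : condOp (T * Tᴴ) (ketbra x) a a' =
      ∑ b, ∑ b', ketbra x b b' * (T * Tᴴ) (a, b') (a', b) := by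
    refine Finset.sum_congr rfl fun b _ => ?_
    rw [mul_apply, Fintype.sum_prod_type, Finset.sum_eq_single a]
    · simp
    · intro d _ hd
      simp [hd.symm]
    · simp
  rw [h, Finset.sum_comm]
  simp only [traceB, swapPurification, ketbra, of_apply, mul_apply, vecMulVec_apply,
    conjTranspose_apply, mulVec, dotProduct, Pi.star_apply, star_sum, Finset.sum_mul_sum,
    star_mul', star_star]
  symm
  rw [Finset.sum_comm]
  refine Finset.sum_congr rfl fun b _ => ?_
  rw [Finset.sum_comm]
  refine Finset.sum_congr rfl fun b' _ => ?_
  rw [Finset.mul_sum]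
  refine Finset.sum_congr rfl fun c _ => ?_
  ring

open Matrix in
theorem traceB_swapPurification {A B C : Type*} [Fintype B] [Fintype C]
    (T : Matrix (A × B) C ℂ) :
    traceB (swapPurification T * (swapPurification T)ᴴ) = traceB (T * Tᴴ) := by
  ext a a'
  simp only [traceB, swapPurification, of_apply, mul_apply, conjTranspose_apply]
  exact Finset.sum_comm

open Matrix in
theorem traceA_swapPurification {A B C : Type*} [Fintype A] [Fintype B] [Fintype C]
    (T : Matrix (A × B) C ℂ) :
    traceA (swapPurification T * (swapPurification T)ᴴ) = (Tᴴ * T)ᵀ := by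
  ext c c'
  simp only [traceA, swapPurification, of_apply, mul_apply, conjTranspose_apply, transpose_apply,
    Fintype.sum_prod_type, mul_comm]

-- After the exchange, `S(AC) = S(B)` and `S(C) = S(AB)`, so the criterion for `W` is the same
-- entropy equation. The value `J = S(A) - S(AB)` says that the average conditional entropy has
-- infimum `S(C)`.
open Matrix in
theorem classicalCorr_eq_iff {A B : Type*} [Fintype A] [DecidableEq A] [Fintype B]
    [DecidableEq B] {ρ : Matrix (A × B) (A × B) ℂ} (hρ : IsState ρ) :
    classicalCorr ρ = entropy (traceB ρ) - entropy ρ ↔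
      entropy (traceB ρ) = entropy (traceA ρ) + entropy ρ := by
  obtain ⟨T, rfl⟩ := hρ.posSemidef.exists_eq_mul_conjTranspose
  set W := swapPurification T with hW
  have hSA : traceB (W * Wᴴ) = traceB (T * Tᴴ) := traceB_swapPurification T
  have hSC : entropy (traceA (W * Wᴴ)) = entropy (T * Tᴴ) := by
    rw [hW, traceA_swapPurification, entropy_transpose (isHermitian_conjTranspose_mul_self T),
      entropy_mul_conjTranspose]
  have hSB : entropy (W * Wᴴ) = entropy (traceA (T * Tᴴ)) := by
    have : traceA (T * Tᴴ) = (Wᴴ * W)ᵀ := traceA_swapPurification W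
    rw [this, entropy_transpose (isHermitian_conjTranspose_mul_self W),
      entropy_mul_conjTranspose]
  have hstate : IsState (W * Wᴴ) :=
    ⟨posSemidef_self_mul_conjTranspose W, by
      rw [← trace_traceB, hSA, trace_traceB, hρ.trace_eq_one]⟩
  have hcore := entropy_eq_add_iff_traceA_ketbra_mulVec W hstate
  rw [hSA, hSC, hSB, add_comm] at hcore
  rw [hcore]
  constructor
  · intro h
    refine traceA_ketbra_mulVec_of_le hstate fun v hv => ?_
    -- The conjugation in `condOp_ketbra` requires the conjugate measurement; it is still a
    -- resolution of the identity, by transposition.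
    have hv' : ∑ i, ketbra (star (v i)) = 1 := by
      have := congrArg transpose hv
      rw [transpose_sum, transpose_one] at this
      rw [← this]
      refine Finset.sum_congr rfl fun i _ => ?_
      rw [ketbra, ketbra, transpose_vecMulVec, star_star]
    have := le_csSup (gainSet_bddAbove hρ)
      (sub_sum_homEntropy_condOp_mem_gainSet (T * Tᴴ)
        (fun i => posSemidef_ketbra (star (v i))) hv')
    change _ ≤ classicalCorr (T * Tᴴ) at this
    simp only [h, condOp_ketbra, star_star] at this
    rw [hSC]
    linarith
  · intro h
    have hpure : ∀ x : B → ℂ, homEntropy (condOp (T * Tᴴ) (ketbra x)) =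
        (condOp (T * Tᴴ) (ketbra x)).trace.re * entropy (T * Tᴴ) := by
      intro x
      rw [condOp_ketbra, homEntropy_traceB_ketbra, ← hW, h, homEntropy_trace_smul
        (posSemidef_ketbra _) (by rw [trace_traceA, hstate.trace_eq_one]), hSC, trace_traceB]
    -- Every effect splits into rank one effects, and by superadditivity merging their conditional
    -- operators cannot lower the homogeneous entropy.
    have hgen : ∀ E : Matrix B B ℂ, E.PosSemidef →
        (condOp (T * Tᴴ) E).trace.re * entropy (T * Tᴴ) ≤ homEntropy (condOp (T * Tᴴ) E) := by
      intro E hE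
      obtain ⟨F, rfl⟩ := hE.exists_eq_mul_conjTranspose
      rw [← sum_ketbra_col F, condOp_sum, trace_sum, Complex.re_sum, Finset.sum_mul]
      simp only [← hpure]
      exact sum_homEntropy_le_homEntropy_sum fun i =>
        posSemidef_condOp hρ.posSemidef (posSemidef_ketbra _)
    -- The supremum is attained by measuring `B` in the standard basis.
    refine IsGreatest.csSup_eq ⟨?_, ?_⟩
    · have h1 : ∑ b, ketbra (fun i => (1 : Matrix B B ℂ) i b) = 1 := by
        rw [sum_ketbra_col, conjTranspose_one, Matrix.one_mul]
      have := sub_sum_homEntropy_condOp_mem_gainSet (T * Tᴴ) (fun b => posSemidef_ketbra _) h1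
      simp only [hpure] at this
      rwa [← Finset.sum_mul, sum_re_trace_condOp hρ h1, one_mul] at this
    · rintro x ⟨k, E, rfl⟩
      have := Finset.sum_le_sum fun i (_ : i ∈ Finset.univ) => hgen _ (E.posSemidef i)
      rw [← Finset.sum_mul, sum_re_trace_condOp hρ E.sum_eq_one, one_mul,
        ← avgCondEntropy_eq_sum_homEntropy] at this
      linarith

end QInfo

theorem lemma1 {A B : Type*} [Fintype A] [DecidableEq A] [Fintype B] [DecidableEq B]
    (ρ : Matrix (A × B) (A × B) ℂ) (hρ : QInfo.IsState ρ) :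
    List.TFAE [
      QInfo.discord ρ = QInfo.entropy (QInfo.traceA ρ),
      QInfo.entropy (QInfo.traceB ρ) - QInfo.entropy (QInfo.traceA ρ) = QInfo.entropy ρ,
      QInfo.entForm ρ = QInfo.entropy (QInfo.traceA ρ)] := by
  have h1 := QInfo.classicalCorr_eq_iff hρ
  have h3 := QInfo.entForm_eq_iff hρ
  -- The term `S(B)` cancels, leaving `J = S(A) - S(AB)`.
  tfae_have 1 ↔ 2 := by
    rw [QInfo.discord, QInfo.mutualInfo]
    constructor <;> intro h
    · linarith [h1.mp (by linarith)]
    · linarith [h1.mpr (by linarith)]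
  tfae_have 2 ↔ 3 := by
    rw [h3, sub_eq_iff_eq_add']
  tfae_finish
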